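/- Let $m\ge 0$, and let $(x_r)_{r\in\mathbb Z}$ be complex $m\times m$ matrices, all but finitely many equal to zero. Put $x(z)=\sum_r x_r z^r$ for $z\in\mathbb C\setminus\{0\}$. Let $X$ be the banded block-Toeplitz operator with symbol $x$, that is, the bounded operator on $\ell^2(\mathbb Z_{>0})\otimes\mathbb C^m$ with $(i,j)$ block $x_{j-i}$ $(i,j\ge1)$, and let $\widetilde X$ be the associated block-Toeplitz operator, whose $(i,j)$ block is $x_{i-j}$ (its symbol is $x(1/z)$). A *plus factor* is a matrix function $A_+(z)=\sum_{n\ge0}a_nz^n$ with $\sum_n\|a_n\|<\infty$ that is invertible for all $|z|\le1$; a *minus factor* is a matrix function $A_-(z)=\sum_{n\ge0}a_nz^{-n}$ with $\sum_n\|a_n\|<\infty$ that is invertible for all $|z|\ge1$, including $z=\infty$ (i.e. $a_0$ is invertible). For a matrix function $y$ on the unit circle, integers $\kappa_1,\dots,\kappa_m$ are *left partial indices* of $y$ if there are a plus factor $A_+$ and a minus factor $A_-$ with $y(z)=A_+(z)\,\mathrm{diag}(z^{\kappa_1},\dots,z^{\kappa_m})\,A_-(z)$ for $|z|=1$; integers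 $\mu_1,\dots,\mu_m$ are *right partial indices* of $y$ if there are a minus factor $B_-$ and a plus factor $B_+$ with $y(z)=B_-(z)\,\mathrm{diag}(z^{\mu_1},\dots,z^{\mu_m})\,B_+(z)$ for $|z|=1$. Then for every $\lambda\in\mathbb C$: 1. $\lambda\in\sigma(X)$ if and only if (i) $\lambda\in\sigma(x(e^{ik}))$ for some $k\in\mathbb R$, or (ii) $x(z)-\lambda\mathbf 1_m$ has left partial indices at least one of which is non-zero. 2. $\lambda\in\sigma(\widetilde X)$ if and only if (i) $\lambda\in\sigma(x(e^{ik}))$ for some $k\in\mathbb R$, or (ii) $x(z)-\lambda\mathbf 1_m$ has right partial indices at least one of which is non-zero. -/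

import Mathlib

/-- The Hilbert space `ℓ²(ℤ_{>0}) ⊗ ℂ^m` of square-summable sequences of vectors of `ℂ^m`.
The sites `1, 2, 3, …` are labelled `0, 1, 2, …`. -/
abbrev HalfLineSpace (m : ℕ) : Type :=
  lp (fun _ : ℕ => EuclideanSpace ℂ (Fin m)) 2

/-- The sequence `i ↦ A u_{i+r}`, where `u_j` is read as `0` for `j < 0`. -/
noncomputable def shiftSeq {m : ℕ} (r : ℤ) (A : Matrix (Fin m) (Fin m) ℂ)
    (u : ℕ → EuclideanSpace ℂ (Fin m)) (i : ℕ) : EuclideanSpace ℂ (Fin m) :=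
  if 0 ≤ (i : ℤ) + r then Matrix.toEuclideanCLM (𝕜 := ℂ) A (u ((i : ℤ) + r).toNat) else 0

theorem shiftSeq_sum_le {m : ℕ} (r : ℤ) (A : Matrix (Fin m) (Fin m) ℂ)
    (u : HalfLineSpace m) (s : Finset ℕ) :
    ∑ i ∈ s, ‖shiftSeq r A (fun n => u n) i‖ ^ (2 : ENNReal).toReal ≤
      (‖Matrix.toEuclideanCLM (𝕜 := ℂ) A‖ * ‖u‖) ^ (2 : ENNReal).toReal := by
  have h2 : (2 : ENNReal).toReal = 2 := by norm_num
  set L := Matrix.toEuclideanCLM (𝕜 := ℂ) A with hL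
  have hp : 0 < (2 : ENNReal).toReal := by norm_num
  calc ∑ i ∈ s, ‖shiftSeq r A (fun n => u n) i‖ ^ (2 : ENNReal).toReal
      ≤ ∑ i ∈ s.filter (fun i : ℕ => 0 ≤ (i : ℤ) + r),
          ‖L‖ ^ (2 : ENNReal).toReal * ‖u ((i : ℤ) + r).toNat‖ ^ (2 : ENNReal).toReal := by
        rw [Finset.sum_filter]
        refine Finset.sum_le_sum fun i _ => ?_
        unfold shiftSeq
        split_ifs with h
        · rw [← Real.mul_rpow (norm_nonneg _) (norm_nonneg _)]
          exact Real.rpow_le_rpow (norm_nonneg _) (L.le_opNorm _) hp.le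
        · simp
    _ = ‖L‖ ^ (2 : ENNReal).toReal *
          ∑ j ∈ (s.filter fun i : ℕ => 0 ≤ (i : ℤ) + r).image fun i : ℕ => ((i : ℤ) + r).toNat,
            ‖u j‖ ^ (2 : ENNReal).toReal := by
        rw [← Finset.mul_sum, Finset.sum_image]
        intro a ha b hb hab
        simp only [Finset.coe_filter, Set.mem_ofPred_eq] at ha hb
        have := ha.2
        have := hb.2
        dsimp only at hab
        omega
    _ ≤ ‖L‖ ^ (2 : ENNReal).toReal * ‖u‖ ^ (2 : ENNReal).toReal := by
        gcongr
        exact lp.sum_rpow_le_norm_rpow hp u _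
    _ = _ := by rw [Real.mul_rpow (norm_nonneg _) (norm_nonneg _)]

theorem shiftSeq_memℓp {m : ℕ} (r : ℤ) (A : Matrix (Fin m) (Fin m) ℂ) (u : HalfLineSpace m) :
    Memℓp (shiftSeq r A (fun n => u n)) 2 :=
  memℓp_gen' (shiftSeq_sum_le r A u)

/-- The bounded operator `T^r ⊗ A` for `r ≥ 0` and `(T†)^(-r) ⊗ A` for `r < 0` on
`ℓ²(ℤ_{>0}) ⊗ ℂ^m`, where `T = ∑ e_j e_{j+1}†` is the left shift. -/
noncomputable def shiftTensor {m : ℕ} (r : ℤ) (A : Matrix (Fin m) (Fin m) ℂ) :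
    HalfLineSpace m →L[ℂ] HalfLineSpace m :=
  LinearMap.mkContinuous
    { toFun := fun u => ⟨shiftSeq r A (fun n => u n), shiftSeq_memℓp r A u⟩
      map_add' := by
        intro u v
        ext i : 2
        change shiftSeq r A _ i = shiftSeq r A _ i + shiftSeq r A _ i
        unfold shiftSeq
        split_ifs <;> simp
      map_smul' := by
        intro c u
        ext i : 2
        change shiftSeq r A _ i = c • shiftSeq r A _ i
        unfold shiftSeq
        split_ifs <;> simp }
    ‖Matrix.toEuclideanCLM (𝕜 := ℂ) A‖
    (fun u => lp.norm_le_of_forall_sum_le (by norm_num) (by positivity) (shiftSeq_sum_le r A u))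

/-- The banded block-Toeplitz operator
`X = 1 ⊗ x_0 + ∑_{r ≥ 1} (T^r ⊗ x_r + (T†)^r ⊗ x_{-r})`, that is, the infinite block matrix whose
`(i, j)` block is `x_{j-i}`. Bandedness is the finite support of the family `(x_r)`. -/
noncomputable def blockToeplitz {m : ℕ} (x : ℤ →₀ Matrix (Fin m) (Fin m) ℂ) :
    HalfLineSpace m →L[ℂ] HalfLineSpace m :=
  x.sum fun r A => shiftTensor r A

/-- The coefficients `x_{-r}` of the associated symbol `x(1/z)`. -/
noncomputable def reflectCoeff {m : ℕ} (x : ℤ →₀ Matrix (Fin m) (Fin m) ℂ) :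
    ℤ →₀ Matrix (Fin m) (Fin m) ℂ :=
  x.equivMapDomain (Equiv.neg ℤ)

/-- The associated block-Toeplitz operator: its `(i, j)` block is `x_{i-j}`. -/
noncomputable def associatedBlockToeplitz {m : ℕ} (x : ℤ →₀ Matrix (Fin m) (Fin m) ℂ) :
    HalfLineSpace m →L[ℂ] HalfLineSpace m :=
  blockToeplitz (reflectCoeff x)

theorem blockToeplitz_apply {m : ℕ} (x : ℤ →₀ Matrix (Fin m) (Fin m) ℂ) (u : HalfLineSpace m)
    (i : ℕ) : blockToeplitz x u i = ∑ r ∈ x.support, shiftSeq r (x r) (fun n => u n) i := by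
  unfold blockToeplitz Finsupp.sum
  rw [_root_.sum_apply, lp.coeFn_sum, Finset.sum_apply]
  rfl

/-- The `(i, j)` block of `X` is `x_{j-i}`. -/
theorem blockToeplitz_single {m : ℕ} (x : ℤ →₀ Matrix (Fin m) (Fin m) ℂ) (i j : ℕ)
    (v : EuclideanSpace ℂ (Fin m)) :
    blockToeplitz x (lp.single (E := fun _ : ℕ => EuclideanSpace ℂ (Fin m)) 2 j v) i =
      Matrix.toEuclideanCLM (𝕜 := ℂ) (x ((j : ℤ) - i)) v := by
  have hterm : ∀ r : ℤ, shiftSeq r (x r)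
      (fun n => lp.single (E := fun _ : ℕ => EuclideanSpace ℂ (Fin m)) 2 j v n) i =
      if r = (j : ℤ) - i then Matrix.toEuclideanCLM (𝕜 := ℂ) (x r) v else 0 := by
    intro r
    unfold shiftSeq
    by_cases h : r = (j : ℤ) - i
    · have h1 : ((i : ℤ) + r).toNat = j := by omega
      rw [if_pos h, if_pos (by omega), h1]
      exact congrArg _ (lp.single_apply_self (E := fun _ : ℕ => EuclideanSpace ℂ (Fin m)) 2 j v)
    · rw [if_neg h]
      split_ifs with h0
      · have h1 : ((i : ℤ) + r).toNat ≠ j := by omega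
        exact (congrArg _ (lp.single_apply_ne (E := fun _ : ℕ => EuclideanSpace ℂ (Fin m))
          2 j v h1)).trans (map_zero _)
      · rfl
  rw [blockToeplitz_apply, Finset.sum_congr rfl fun r _ => hterm r, Finset.sum_ite_eq']
  split_ifs with h
  · rfl
  · rw [Finsupp.notMem_support_iff.mp h, map_zero]
    rfl

/-- The `(i, j)` block of the associated operator is `x_{i-j}`. -/
theorem associatedBlockToeplitz_single {m : ℕ} (x : ℤ →₀ Matrix (Fin m) (Fin m) ℂ) (i j : ℕ)
    (v : EuclideanSpace ℂ (Fin m)) :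
    associatedBlockToeplitz x
        (lp.single (E := fun _ : ℕ => EuclideanSpace ℂ (Fin m)) 2 j v) i =
      Matrix.toEuclideanCLM (𝕜 := ℂ) (x ((i : ℤ) - j)) v := by
  rw [associatedBlockToeplitz, blockToeplitz_single]
  simp [reflectCoeff, Finsupp.equivMapDomain_apply]

/-- The symbol `x(z) = ∑_r x_r z^r`, a matrix Laurent polynomial. -/
noncomputable def blockSymbol {m : ℕ} (x : ℤ →₀ Matrix (Fin m) (Fin m) ℂ) (z : ℂ) :
    Matrix (Fin m) (Fin m) ℂ :=
  x.sum fun r A => z ^ r • A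

/-- `A` is a plus factor: `A(z) = ∑_{n ≥ 0} a_n z^n` with absolutely summable coefficients, and
`A(z)` is invertible for all `|z| ≤ 1`. -/
def IsPlusFactor {m : ℕ} (A : ℂ → Matrix (Fin m) (Fin m) ℂ) : Prop :=
  ∃ a : ℕ → Matrix (Fin m) (Fin m) ℂ,
    (∀ i j, Summable fun n => ‖a n i j‖) ∧
    (∀ z : ℂ, ‖z‖ ≤ 1 → HasSum (fun n => z ^ n • a n) (A z)) ∧
    (∀ z : ℂ, ‖z‖ ≤ 1 → IsUnit (A z))

/-- `A` is a minus factor: `A(z) = ∑_{n ≥ 0} a_n z^{-n}` with absolutely summable coefficients, and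
`A(z)` is invertible for all `|z| ≥ 1`, including `z = ∞`, where the value of `A` is `a_0`. -/
def IsMinusFactor {m : ℕ} (A : ℂ → Matrix (Fin m) (Fin m) ℂ) : Prop :=
  ∃ a : ℕ → Matrix (Fin m) (Fin m) ℂ,
    (∀ i j, Summable fun n => ‖a n i j‖) ∧
    (∀ z : ℂ, 1 ≤ ‖z‖ → HasSum (fun n => z⁻¹ ^ n • a n) (A z)) ∧
    (∀ z : ℂ, 1 ≤ ‖z‖ → IsUnit (A z)) ∧
    IsUnit (a 0)

/-- `κ` is a tuple of left partial indices of `x`: there is a left Wiener-Hopf factorization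
`x(z) = A₊(z) diag(z^{κ_1}, …, z^{κ_m}) A₋(z)` on the unit circle. -/
def HasLeftPartialIndices {m : ℕ} (x : ℂ → Matrix (Fin m) (Fin m) ℂ) (κ : Fin m → ℤ) : Prop :=
  ∃ Ap Am : ℂ → Matrix (Fin m) (Fin m) ℂ, IsPlusFactor Ap ∧ IsMinusFactor Am ∧
    ∀ z : ℂ, ‖z‖ = 1 → x z = Ap z * Matrix.diagonal (fun j => z ^ κ j) * Am z

/-- `μ` is a tuple of right partial indices of `x`: there is a right Wiener-Hopf factorization
`x(z) = B₋(z) diag(z^{μ_1}, …, z^{μ_m}) B₊(z)` on the unit circle. -/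
def HasRightPartialIndices {m : ℕ} (x : ℂ → Matrix (Fin m) (Fin m) ℂ) (μ : Fin m → ℤ) : Prop :=
  ∃ Bm Bp : ℂ → Matrix (Fin m) (Fin m) ℂ, IsMinusFactor Bm ∧ IsPlusFactor Bp ∧
    ∀ z : ℂ, ‖z‖ = 1 → x z = Bm z * Matrix.diagonal (fun j => z ^ μ j) * Bp z

/-! Absorbing `lam` into `x_0`, the question is when `blockToeplitz x` is invertible. The symbol `z
^ r` corresponds to `T ^ r`, with `T` the left shift, and to a power of `T†` when `r < 0`. Since `T
T† = 1` but `T† T ≠ 1`, the passage from symbols to operators is multiplicative once nonnegative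
powers stand on the left or nonpositive ones on the right. A left factorization `A₊ D A₋` has this
order, so it gives `X = Y D Z` for the operators. Gelfand theory in the commutative Banach algebra
generated by a shift makes `Y` and `Z` invertible, and `D`, the direct sum of the `T ^ κ_j`, is
invertible exactly when all `κ_j` vanish (`HasLeftPartialIndices.isUnit_blockToeplitz_iff`). Any
single factorization thus decides invertibility, and uniqueness of the indices is not needed.

Two facts complete the criterion. If the symbol is singular at a point of the circle, truncated
plane waves show that `X` has no bounded inverse (`isUnit_blockSymbol_of_isUnit_blockToeplitz`). If
it is invertible on the whole circle, a factorization exists (`exists_hasLeftPartialIndices`): the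
zeros of the determinant inside the disc are moved one at a time across the diagonal factor. The
associated operator follows from the substitution `z ↦ 1/z`, which exchanges left and right
factorizations and negates the indices. -/

/-! ### Invertibility of matrix power series in a contraction, by Gelfand theory -/

/-- The algebra homomorphism `Matrix n n 𝒜 → B` attached to commuting homomorphisms from `𝒜` and
from the complex matrices. -/
noncomputable def matrixLift {n 𝒜 B : Type*} [Fintype n] [DecidableEq n] [CommRing 𝒜] [Algebra ℂ 𝒜]
    [Ring B] [Algebra ℂ B] (f : 𝒜 →ₐ[ℂ] B) (ρ : Matrix n n ℂ →ₐ[ℂ] B)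
    (h : ∀ x A, Commute (f x) (ρ A)) : Matrix n n 𝒜 →ₐ[ℂ] B :=
  (Algebra.TensorProduct.lift f ρ h).comp (matrixEquivTensor n ℂ 𝒜).toAlgHom

theorem matrixLift_apply {n 𝒜 B : Type*} [Fintype n] [DecidableEq n] [CommRing 𝒜] [Algebra ℂ 𝒜]
    [Ring B] [Algebra ℂ B] (f : 𝒜 →ₐ[ℂ] B) (ρ : Matrix n n ℂ →ₐ[ℂ] B)
    (h : ∀ x A, Commute (f x) (ρ A)) (M : Matrix n n 𝒜) :
    matrixLift f ρ h M = ∑ p : n × n, f (M p.1 p.2) * ρ (Matrix.single p.1 p.2 1) := by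
  simp [matrixLift, matrixEquivTensor_apply]

/-- An element of a commutative complex Banach algebra given by an absolutely summable matrix power
series in a contraction is invertible if the power series is invertible on the closed disc. -/
theorem isUnit_matrix_of_powerSeries {n 𝒜 : Type*} [Fintype n] [DecidableEq n] [NormedCommRing 𝒜]
    [NormedAlgebra ℂ 𝒜] [CompleteSpace 𝒜] {s : 𝒜} (hs : ∀ φ : WeakDual.characterSpace ℂ 𝒜, ‖φ s‖ ≤ 1)
    {a : ℕ → Matrix n n ℂ} {F : ℂ → Matrix n n ℂ}
    (hF : ∀ z : ℂ, ‖z‖ ≤ 1 → HasSum (fun k => z ^ k • a k) (F z))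
    (hu : ∀ z : ℂ, ‖z‖ ≤ 1 → IsUnit (F z))
    {M : Matrix n n 𝒜} (hM : ∀ i j, HasSum (fun k => a k i j • s ^ k) (M i j)) : IsUnit M := by
  rw [Matrix.isUnit_iff_isUnit_det]
  by_contra hdet
  -- A non-unit of a commutative Banach algebra is killed by some character. Entrywise, `φ` turns
  -- `M` into `F (φ s)`, which is invertible because `φ s` lies in the closed disc.
  obtain ⟨φ, hφ⟩ := WeakDual.CharacterSpace.exists_apply_eq_zero hdet
  let ψ : 𝒜 →+* ℂ := WeakDual.CharacterSpace.toAlgHom φ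
  have hMF : ψ.mapMatrix M = F (φ s) := by
    ext i j
    have h1 : HasSum (fun k => φ (a k i j • s ^ k)) (φ (M i j)) :=
      (hM i j).map φ (map_continuous φ)
    have h2 : HasSum (fun k => (φ s ^ k • a k) i j) (F (φ s) i j) :=
      Pi.hasSum.1 (Pi.hasSum.1 (hF _ (hs φ)) i) j
    have h3 : (fun k => φ (a k i j • s ^ k)) = fun k => (φ s ^ k • a k) i j := by
      funext k
      simp [mul_comm]
    rw [h3] at h1
    exact h1.unique h2
  have h4 : ψ M.det = (F (φ s)).det := by rw [RingHom.map_det, hMF]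
  have h5 : ψ M.det = 0 := hφ
  have h6 := (Matrix.isUnit_iff_isUnit_det _).1 (hu _ (hs φ))
  rw [← h4, h5] at h6
  exact not_isUnit_zero h6

/-- The closed subalgebra generated by `s` is commutative, so the series is already invertible as a
matrix over it. The inverse is carried to `B` by `matrixLift`, available because `s` commutes with
the image of `ρ`. -/
theorem isUnit_powerSeries_of_commute {n B : Type*} [Fintype n] [DecidableEq n] [NormedRing B]
    [NormedAlgebra ℂ B] [CompleteSpace B] [NormOneClass B] (ρ : Matrix n n ℂ →ₐ[ℂ] B) {s : B}
    (hs : ‖s‖ ≤ 1) (hcomm : ∀ A, Commute s (ρ A)) {a : ℕ → Matrix n n ℂ}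
    {F : ℂ → Matrix n n ℂ} (ha : ∀ i j, Summable fun k => ‖a k i j‖)
    (hF : ∀ z : ℂ, ‖z‖ ≤ 1 → HasSum (fun k => z ^ k • a k) (F z))
    (hu : ∀ z : ℂ, ‖z‖ ≤ 1 → IsUnit (F z))
    {Y : B} (hY : HasSum (fun k => s ^ k * ρ (a k)) Y) : IsUnit Y := by
  let 𝒜 := Algebra.elemental ℂ s
  let t : 𝒜 := ⟨s, Algebra.elemental.self_mem ℂ s⟩
  let _ : NormedCommRing 𝒜 := { (inferInstance : NormedRing 𝒜) with mul_comm := mul_comm }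
  have hsum : ∀ i j, Summable fun k => a k i j • t ^ k := by
    intro i j
    refine Summable.of_norm_bounded (ha i j) fun k => ?_
    rw [norm_smul]
    refine mul_le_of_le_one_right (norm_nonneg _) ?_
    have : ‖t ^ k‖ = ‖s ^ k‖ := rfl
    rw [this]
    exact (norm_pow_le s k).trans (pow_le_one₀ (norm_nonneg _) hs)
  let M : Matrix n n 𝒜 := fun i j => ∑' k, a k i j • t ^ k
  have hM : ∀ i j, HasSum (fun k => a k i j • t ^ k) (M i j) := fun i j => (hsum i j).hasSum
  have hMu : IsUnit M := by
    refine isUnit_matrix_of_powerSeries (s := t) (fun φ => ?_) hF hu hM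
    have h1 : φ t ∈ spectrum ℂ t := AlgHom.apply_mem_spectrum (WeakDual.CharacterSpace.toAlgHom φ) t
    have : NormOneClass 𝒜 := ⟨norm_one (α := B)⟩
    exact (spectrum.norm_le_norm_of_mem h1).trans hs
  have hc : ∀ (x : 𝒜) (A : Matrix n n ℂ), Commute (𝒜.val x) (ρ A) := by
    intro x A
    -- The centralizer is closed and contains `s`, hence the whole closed algebra that `s`
    -- generates.
    have h1 : 𝒜 ≤ Subalgebra.centralizer ℂ {ρ A} := by
      refine Algebra.elemental.le_of_mem (Set.isClosed_centralizer _) ?_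
      rw [Subalgebra.mem_centralizer_iff]
      rintro _ rfl
      exact (hcomm A).symm
    exact ((Subalgebra.mem_centralizer_iff ℂ).1 (h1 x.2) _ rfl).symm
  have hY' : HasSum (fun k => s ^ k * ρ (a k)) (matrixLift 𝒜.val ρ hc M) := by
    rw [matrixLift_apply]
    have h1 : (fun k => s ^ k * ρ (a k)) = fun k => ∑ p : n × n,
        (a k p.1 p.2 • s ^ k) * ρ (Matrix.single p.1 p.2 1) := by
      funext k
      conv_lhs => rw [Matrix.matrix_eq_sum_single (a k)]
      rw [Fintype.sum_prod_type]
      simp only [map_sum, Finset.mul_sum]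
      refine Finset.sum_congr rfl fun i _ => Finset.sum_congr rfl fun j _ => ?_
      have : Matrix.single i j (a k i j) = a k i j • Matrix.single i j (1 : ℂ) := by simp
      rw [this, map_smul, mul_smul_comm, smul_mul_assoc]
    rw [h1]
    refine hasSum_sum fun p _ => HasSum.mul_right _ ?_
    exact (hM p.1 p.2).map 𝒜.val continuous_subtype_val
  rw [hY.unique hY']
  exact hMu.map (matrixLift 𝒜.val ρ hc)

/-! ### Algebra and norms of the operators `T ^ r ⊗ A` -/

theorem shiftTensor_apply {m : ℕ} (r : ℤ) (A : Matrix (Fin m) (Fin m) ℂ) (u : HalfLineSpace m)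
    (i : ℕ) : shiftTensor r A u i =
      if 0 ≤ (i : ℤ) + r then Matrix.toEuclideanCLM (𝕜 := ℂ) A (u ((i : ℤ) + r).toNat) else 0 :=
  rfl

theorem norm_shiftTensor_le {m : ℕ} (r : ℤ) (A : Matrix (Fin m) (Fin m) ℂ) :
    ‖shiftTensor r A‖ ≤ ‖Matrix.toEuclideanCLM (𝕜 := ℂ) A‖ :=
  LinearMap.mkContinuous_norm_le _ (norm_nonneg _) _

/-- In the excluded case `r < 0 < s`, the product first discards initial sites and then refills them
with zeros, so it differs from a single shift. -/
theorem shiftTensor_mul {m : ℕ} {r s : ℤ} (h : 0 ≤ r ∨ s ≤ 0) (A B : Matrix (Fin m) (Fin m) ℂ) :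
    shiftTensor r A * shiftTensor s B = shiftTensor (r + s) (A * B) := by
  ext u i : 3
  rw [mul_apply_eq_comp]
  simp only [shiftTensor_apply, map_mul]
  by_cases h1 : 0 ≤ (i : ℤ) + r
  · have h2 : (((i : ℤ) + r).toNat : ℤ) + s = i + (r + s) := by omega
    rw [if_pos h1, h2]
    split_ifs <;> simp
  · rw [if_neg h1, if_neg (by omega)]

theorem shiftTensor_add {m : ℕ} (r : ℤ) (A B : Matrix (Fin m) (Fin m) ℂ) :
    shiftTensor r (A + B) = shiftTensor r A + shiftTensor r B := by
  ext u i : 3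
  change shiftTensor r (A + B) u i = shiftTensor r A u i + shiftTensor r B u i
  simp only [shiftTensor_apply, map_add]
  split_ifs <;> simp

theorem shiftTensor_smul {m : ℕ} (r : ℤ) (c : ℂ) (A : Matrix (Fin m) (Fin m) ℂ) :
    shiftTensor r (c • A) = c • shiftTensor r A := by
  ext u i : 3
  change shiftTensor r (c • A) u i = c • shiftTensor r A u i
  simp only [shiftTensor_apply, map_smul]
  split_ifs <;> simp

theorem shiftTensor_zero_one {m : ℕ} : shiftTensor 0 (1 : Matrix (Fin m) (Fin m) ℂ) = 1 := by
  ext u i : 3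
  simp [shiftTensor_apply]

/-- The embedding `A ↦ 1 ⊗ A` of the matrices. -/
noncomputable def shiftTensorZero (m : ℕ) :
    Matrix (Fin m) (Fin m) ℂ →ₐ[ℂ] (HalfLineSpace m →L[ℂ] HalfLineSpace m) :=
  AlgHom.ofLinearMap
    { toFun := shiftTensor 0
      map_add' := shiftTensor_add 0
      map_smul' := shiftTensor_smul 0 }
    shiftTensor_zero_one fun A B => by simpa using (shiftTensor_mul (Or.inl le_rfl) A B).symm

theorem norm_shiftTensor_one_le {m : ℕ} (r : ℤ) :
    ‖shiftTensor r (1 : Matrix (Fin m) (Fin m) ℂ)‖ ≤ 1 := by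
  refine (norm_shiftTensor_le r 1).trans ?_
  rw [map_one]
  exact ContinuousLinearMap.norm_id_le

theorem shiftTensor_one_pow {m : ℕ} (r : ℤ) (k : ℕ) :
    shiftTensor r (1 : Matrix (Fin m) (Fin m) ℂ) ^ k = shiftTensor (k * r) 1 := by
  induction k with
  | zero => simp [shiftTensor_zero_one]
  | succ k ih =>
    have h : 0 ≤ (k : ℤ) * r ∨ r ≤ 0 := by
      rcases le_total 0 r with h | h
      · exact Or.inl (by positivity)
      · exact Or.inr h
    rw [pow_succ, ih, shiftTensor_mul h, mul_one]
    congr 1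
    push_cast
    ring

theorem summable_norm_toEuclideanCLM {m : ℕ} {ι : Type*} {a : ι → Matrix (Fin m) (Fin m) ℂ}
    (ha : ∀ i j, Summable fun k => ‖a k i j‖) :
    Summable fun k => ‖Matrix.toEuclideanCLM (𝕜 := ℂ) (a k)‖ := by
  have h : Summable fun k => ∑ i, ∑ j, ‖a k i j‖ *
      ‖Matrix.toEuclideanCLM (𝕜 := ℂ) (Matrix.single i j (1 : ℂ))‖ :=
    summable_sum fun i _ => summable_sum fun j _ => (ha i j).mul_right _
  refine Summable.of_nonneg_of_le (fun _ => norm_nonneg _) (fun k => ?_) h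
  conv_lhs => rw [Matrix.matrix_eq_sum_single (a k)]
  rw [map_sum]
  refine (norm_sum_le _ _).trans (Finset.sum_le_sum fun i _ => ?_)
  rw [map_sum]
  refine (norm_sum_le _ _).trans (Finset.sum_le_sum fun j _ => ?_)
  have : Matrix.single i j (a k i j) = a k i j • Matrix.single i j (1 : ℂ) := by simp
  rw [this, map_smul, norm_smul]

theorem summable_norm_shiftTensor {m : ℕ} {ι : Type*} (d : ι → ℤ)
    {a : ι → Matrix (Fin m) (Fin m) ℂ}
    (ha : Summable fun k => ‖Matrix.toEuclideanCLM (𝕜 := ℂ) (a k)‖) :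
    Summable fun k => ‖shiftTensor (d k) (a k)‖ :=
  Summable.of_nonneg_of_le (fun _ => norm_nonneg _) (fun _ => norm_shiftTensor_le _ _) ha

/-- The operator attached to a power series in `T ^ r` is invertible if the power series is
invertible on the closed disc. -/
theorem isUnit_of_hasSum_shiftTensor {m : ℕ} (r : ℤ) {a : ℕ → Matrix (Fin m) (Fin m) ℂ}
    {F : ℂ → Matrix (Fin m) (Fin m) ℂ} (ha : ∀ i j, Summable fun k => ‖a k i j‖)
    (hF : ∀ z : ℂ, ‖z‖ ≤ 1 → HasSum (fun k => z ^ k • a k) (F z))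
    (hu : ∀ z : ℂ, ‖z‖ ≤ 1 → IsUnit (F z)) {Y : HalfLineSpace m →L[ℂ] HalfLineSpace m}
    (hY : HasSum (fun k : ℕ => shiftTensor (k * r) (a k)) Y) : IsUnit Y := by
  -- For `m = 0` the identity operator has norm zero and `NormOneClass` fails, so this case is
  -- separate.
  rcases subsingleton_or_nontrivial (HalfLineSpace m) with h | h
  · have : Y = 1 := by
      ext u : 1
      exact Subsingleton.elim _ _
    rw [this]
    exact isUnit_one
  refine isUnit_powerSeries_of_commute (shiftTensorZero m) (norm_shiftTensor_one_le r)
    (fun A => ?_) ha hF hu (hY.congr_fun ?_)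
  · change shiftTensor r 1 * shiftTensor 0 A = shiftTensor 0 A * shiftTensor r 1
    rw [shiftTensor_mul (Or.inr le_rfl), shiftTensor_mul (Or.inl le_rfl)]
    simp
  · intro k
    change shiftTensor r 1 ^ k * shiftTensor 0 (a k) = _
    rw [shiftTensor_one_pow, shiftTensor_mul (Or.inr le_rfl)]
    simp

theorem shiftTensor_single {m : ℕ} (r : ℤ) (A : Matrix (Fin m) (Fin m) ℂ) (i j : ℕ)
    (v : EuclideanSpace ℂ (Fin m)) :
    shiftTensor r A (lp.single (E := fun _ : ℕ => EuclideanSpace ℂ (Fin m)) 2 j v) i =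
      if r = (j : ℤ) - i then Matrix.toEuclideanCLM (𝕜 := ℂ) A v else 0 := by
  rw [shiftTensor_apply]
  by_cases h : r = (j : ℤ) - i
  · have h1 : ((i : ℤ) + r).toNat = j := by omega
    rw [if_pos h, if_pos (by omega), h1]
    exact congrArg _ (lp.single_apply_self (E := fun _ : ℕ => EuclideanSpace ℂ (Fin m)) 2 j v)
  · rw [if_neg h]
    split_ifs with h0
    · have h1 : ((i : ℤ) + r).toNat ≠ j := by omega
      exact (congrArg _ (lp.single_apply_ne (E := fun _ : ℕ => EuclideanSpace ℂ (Fin m))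
        2 j v h1)).trans (map_zero _)
    · rfl

theorem clm_ext_single {m : ℕ} {Y Z : HalfLineSpace m →L[ℂ] HalfLineSpace m}
    (h : ∀ i j v, Y (lp.single (E := fun _ : ℕ => EuclideanSpace ℂ (Fin m)) 2 j v) i =
      Z (lp.single (E := fun _ : ℕ => EuclideanSpace ℂ (Fin m)) 2 j v) i) : Y = Z := by
  ext u : 1
  have hu := lp.hasSum_single (E := fun _ : ℕ => EuclideanSpace ℂ (Fin m)) (p := 2)
    (by norm_num) u
  refine ((hu.mapL Y).congr_fun fun j => ?_).unique (hu.mapL Z)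
  ext i : 2
  exact (h i j _).symm

/-! ### Fourier coefficients: the symbol on the circle determines the operator -/

theorem integral_exp_int_mul (n : ℤ) :
    ∫ t in (0 : ℝ)..(2 * Real.pi), Complex.exp (Complex.I * t) ^ n =
      if n = 0 then 2 * (Real.pi : ℂ) else 0 := by
  split_ifs with h
  · simp [h]
  · have h1 : ∀ t : ℝ, Complex.exp (Complex.I * t) ^ n = Complex.exp ((n * Complex.I) * t) := by
      intro t
      rw [← Complex.exp_int_mul]
      ring_nf
    simp only [h1]
    have hn : (n : ℂ) * Complex.I ≠ 0 := by simp [h]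
    rw [integral_exp_mul_complex hn]
    have h2 : Complex.exp (n * Complex.I * ((2 * Real.pi : ℝ) : ℂ)) = 1 := by
      rw [Complex.exp_eq_one_iff]
      exact ⟨n, by push_cast; ring⟩
    rw [h2]
    simp

theorem norm_exp_I_mul (t : ℝ) : ‖Complex.exp (Complex.I * t)‖ = 1 := by
  rw [mul_comm, Complex.norm_exp_ofReal_mul_I]

/-- The Fourier coefficients of the sum of an absolutely convergent family of monomials. -/
theorem hasSum_fourier_coeff {E ι : Type*} [NormedAddCommGroup E] [NormedSpace ℂ E]
    [CompleteSpace E] [Countable ι] {d : ι → ℤ} {c : ι → E} (hc : Summable fun p => ‖c p‖)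
    {F : ℂ → E} (hF : ∀ z : ℂ, ‖z‖ = 1 → HasSum (fun p => z ^ d p • c p) (F z)) (s : ℤ) :
    HasSum (fun p => if d p = s then c p else 0)
      ((2 * (Real.pi : ℂ))⁻¹ • ∫ t in (0 : ℝ)..(2 * Real.pi),
        Complex.exp (Complex.I * t) ^ (-s) • F (Complex.exp (Complex.I * t))) := by
  have h := intervalIntegral.hasSum_integral_of_dominated_convergence (μ := MeasureTheory.volume)
    (a := 0) (b := 2 * Real.pi)
    (F := fun p (t : ℝ) => Complex.exp (Complex.I * t) ^ (d p - s) • c p)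
    (f := fun t : ℝ => Complex.exp (Complex.I * t) ^ (-s) • F (Complex.exp (Complex.I * t)))
    (fun p _ => ‖c p‖) (fun p => ?_) (fun p => ?_) ?_ ?_ ?_
  · refine (h.const_smul (2 * (Real.pi : ℂ))⁻¹).congr_fun fun p => ?_
    rw [intervalIntegral.integral_smul_const, integral_exp_int_mul]
    by_cases hp : d p = s
    · rw [if_pos hp, if_pos (by omega), smul_smul, inv_mul_cancel₀, one_smul]
      exact mul_ne_zero two_ne_zero (Complex.ofReal_ne_zero.2 Real.pi_ne_zero)
    · rw [if_neg hp, if_neg (by omega), zero_smul, smul_zero]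
  · have : Continuous fun t : ℝ => Complex.exp (Complex.I * t) ^ (d p - s) :=
      Continuous.zpow₀ (by fun_prop) _ fun t => Or.inl (Complex.exp_ne_zero _)
    exact (this.smul continuous_const).aestronglyMeasurable
  · refine Filter.Eventually.of_forall fun t _ => ?_
    rw [norm_smul, norm_zpow, norm_exp_I_mul, one_zpow, one_mul]
  · exact Filter.Eventually.of_forall fun t _ => hc
  · exact intervalIntegrable_const
  · refine Filter.Eventually.of_forall fun t _ => ?_
    refine ((hF _ (norm_exp_I_mul t)).const_smul _).congr_fun fun p => ?_
    rw [smul_smul, ← zpow_add₀ (Complex.exp_ne_zero _)]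
    congr 2
    ring

/-- The operator `Y` is the sum of the absolutely convergent family `T ^ (d p) ⊗ c p`, and `F` is
the corresponding function on the unit circle. -/
structure IsToeplitzSum {m : ℕ} {ι : Type*} (d : ι → ℤ) (c : ι → Matrix (Fin m) (Fin m) ℂ)
    (Y : HalfLineSpace m →L[ℂ] HalfLineSpace m) (F : ℂ → Matrix (Fin m) (Fin m) ℂ) : Prop where
  summable : Summable fun p => ‖Matrix.toEuclideanCLM (𝕜 := ℂ) (c p)‖
  hasSum : HasSum (fun p => shiftTensor (d p) (c p)) Y
  hasSum_symbol : ∀ z : ℂ, ‖z‖ = 1 →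
    HasSum (fun p => z ^ d p • Matrix.toEuclideanCLM (𝕜 := ℂ) (c p))
      (Matrix.toEuclideanCLM (𝕜 := ℂ) (F z))

/-- Both sides sum those `c p` with `d p = j - i`, applied to `v`. The right side no longer mentions
the chosen expansion, only `F` on the circle. -/
theorem IsToeplitzSum.apply_single {m : ℕ} {ι : Type*} [Countable ι] {d : ι → ℤ}
    {c : ι → Matrix (Fin m) (Fin m) ℂ} {Y : HalfLineSpace m →L[ℂ] HalfLineSpace m}
    {F : ℂ → Matrix (Fin m) (Fin m) ℂ} (h : IsToeplitzSum d c Y F) (i j : ℕ)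
    (v : EuclideanSpace ℂ (Fin m)) :
    Y (lp.single (E := fun _ : ℕ => EuclideanSpace ℂ (Fin m)) 2 j v) i =
      ((2 * (Real.pi : ℂ))⁻¹ • ∫ t in (0 : ℝ)..(2 * Real.pi),
        Complex.exp (Complex.I * t) ^ (-((j : ℤ) - i)) •
          Matrix.toEuclideanCLM (𝕜 := ℂ) (F (Complex.exp (Complex.I * t)))) v := by
  let ℓ : (HalfLineSpace m →L[ℂ] HalfLineSpace m) →L[ℂ] EuclideanSpace ℂ (Fin m) :=
    (lp.evalCLM ℂ (fun _ : ℕ => EuclideanSpace ℂ (Fin m)) 2 i).comp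
      (ContinuousLinearMap.apply ℂ (HalfLineSpace m)
        (lp.single (E := fun _ : ℕ => EuclideanSpace ℂ (Fin m)) 2 j v))
  have h1 := h.hasSum.mapL ℓ
  have h2 := (hasSum_fourier_coeff h.summable h.hasSum_symbol ((j : ℤ) - i)).mapL
    (ContinuousLinearMap.apply ℂ (EuclideanSpace ℂ (Fin m)) v)
  refine (h1.congr_fun fun p => ?_).unique h2
  refine Eq.trans ?_ (shiftTensor_single (d p) (c p) i j v).symm
  split_ifs <;> simp

theorem IsToeplitzSum.eq_of_symbol_eq {m : ℕ} {ι ι' : Type*} [Countable ι] [Countable ι']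
    {d : ι → ℤ} {c : ι → Matrix (Fin m) (Fin m) ℂ} {d' : ι' → ℤ}
    {c' : ι' → Matrix (Fin m) (Fin m) ℂ} {Y Y' : HalfLineSpace m →L[ℂ] HalfLineSpace m}
    {F F' : ℂ → Matrix (Fin m) (Fin m) ℂ} (h : IsToeplitzSum d c Y F)
    (h' : IsToeplitzSum d' c' Y' F') (hF : ∀ z : ℂ, ‖z‖ = 1 → F z = F' z) : Y = Y' := by
  refine clm_ext_single fun i j v => ?_
  rw [h.apply_single, h'.apply_single]
  congr 2
  refine intervalIntegral.integral_congr fun t _ => ?_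
  simp only [hF _ (norm_exp_I_mul t)]

theorem HasSum.mul_of_summable_norm {R ι ι' : Type*} [NormedRing R] [CompleteSpace R] {f : ι → R}
    {g : ι' → R} {a b : R} (hf : HasSum f a) (hg : HasSum g b) (hf' : Summable fun i => ‖f i‖)
    (hg' : Summable fun i => ‖g i‖) : HasSum (fun p : ι × ι' => f p.1 * g p.2) (a * b) :=
  hf.mul hg (summable_mul_of_summable_norm hf' hg')

theorem IsToeplitzSum.summable_norm_symbol {m : ℕ} {ι : Type*} {d : ι → ℤ}
    {c : ι → Matrix (Fin m) (Fin m) ℂ} {Y : HalfLineSpace m →L[ℂ] HalfLineSpace m}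
    {F : ℂ → Matrix (Fin m) (Fin m) ℂ} (h : IsToeplitzSum d c Y F) {z : ℂ} (hz : ‖z‖ = 1) :
    Summable fun p => ‖z ^ d p • Matrix.toEuclideanCLM (𝕜 := ℂ) (c p)‖ := by
  simpa [norm_smul, hz] using h.summable

/-- Absolute convergence allows termwise multiplication over pairs. The sign condition `hd` is what
`shiftTensor_mul` requires of each pair. -/
theorem IsToeplitzSum.mul {m : ℕ} {ι ι' : Type*} {d : ι → ℤ} {c : ι → Matrix (Fin m) (Fin m) ℂ}
    {d' : ι' → ℤ} {c' : ι' → Matrix (Fin m) (Fin m) ℂ}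
    {Y Y' : HalfLineSpace m →L[ℂ] HalfLineSpace m}
    {F F' : ℂ → Matrix (Fin m) (Fin m) ℂ} (h : IsToeplitzSum d c Y F)
    (h' : IsToeplitzSum d' c' Y' F') (hd : (∀ p, 0 ≤ d p) ∨ ∀ q, d' q ≤ 0) :
    IsToeplitzSum (fun p : ι × ι' => d p.1 + d' p.2) (fun p => c p.1 * c' p.2) (Y * Y')
      fun z => F z * F' z := by
  refine ⟨?_, ?_, fun z hz => ?_⟩
  · simpa only [map_mul] using h.summable.mul_norm h'.summable
  · have h1 := h.hasSum.mul_of_summable_norm h'.hasSum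
      (summable_norm_shiftTensor d h.summable) (summable_norm_shiftTensor d' h'.summable)
    refine h1.congr_fun fun p => ?_
    exact (shiftTensor_mul (hd.imp (fun h => h p.1) fun h => h p.2) _ _).symm
  · have hz0 : z ≠ 0 := by
      rintro rfl
      simp at hz
    have h2 := (h.hasSum_symbol z hz).mul_of_summable_norm (h'.hasSum_symbol z hz)
      (h.summable_norm_symbol hz) (h'.summable_norm_symbol hz)
    rw [map_mul]
    refine h2.congr_fun fun p => ?_
    rw [map_mul, zpow_add₀ hz0, smul_mul_smul_comm]
-- Wiener-Hopf factorization of matrix Laurent polynomials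
section PolynomialMatrix

open Polynomial

/-- Evaluation of a matrix of polynomials. -/
noncomputable def polyEval {n : Type*} [Fintype n] [DecidableEq n] (z : ℂ) :
    Matrix n n ℂ[X] →+* Matrix n n ℂ :=
  (Polynomial.evalRingHom z).mapMatrix

theorem det_polyEval {n : Type*} [Fintype n] [DecidableEq n] (z : ℂ) (P : Matrix n n ℂ[X]) :
    (polyEval z P).det = P.det.eval z :=
  ((Polynomial.evalRingHom z).map_det P).symm

theorem isUnit_polyEval {n : Type*} [Fintype n] [DecidableEq n] {z : ℂ} {P : Matrix n n ℂ[X]} :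
    IsUnit (polyEval z P) ↔ P.det.eval z ≠ 0 := by
  rw [Matrix.isUnit_iff_isUnit_det, det_polyEval, isUnit_iff_ne_zero]

theorem det_updateCol_one {n R : Type*} [Fintype n] [DecidableEq n] [CommRing R] (k : n)
    (b : n → R) : ((1 : Matrix n n R).updateCol k b).det = b k := by
  rw [← Matrix.cramer_apply, Matrix.cramer_one]
  rfl

/-- One zero of the determinant of a polynomial matrix is moved to the right of a diagonal
factor. -/
theorem exists_polyEval_mul_diagonal_of_isRoot {n : Type*} [Fintype n] [DecidableEq n]
    (P : Matrix n n ℂ[X]) (κ : n → ℤ) {z₀ : ℂ} (h0 : P.det.IsRoot z₀) :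
    ∃ (P' : Matrix n n ℂ[X]) (κ' : n → ℤ) (Q : Matrix n n ℂ[X]),
      P.det = P'.det * (X - C z₀) ∧ Q.det = 1 - C z₀ * X ∧
      ∀ z : ℂ, z ≠ 0 → polyEval z P * Matrix.diagonal (fun j => z ^ κ j) =
        polyEval z P' * Matrix.diagonal (fun j => z ^ κ' j) * polyEval z⁻¹ Q := by
  have hdet : (polyEval z₀ P).det = 0 := by rw [det_polyEval]; exact h0
  obtain ⟨v, hv, hPv⟩ := Matrix.exists_mulVec_eq_zero_iff.2 hdet
  have hne : (Finset.univ.filter fun i => v i ≠ 0).Nonempty := by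
    obtain ⟨i, hi⟩ := Function.ne_iff.1 hv
    exact ⟨i, by simpa using hi⟩
  -- Minimality of `κ k` on the support of the kernel vector `v` makes the exponents `κ i - κ k`
  -- nonnegative where `v i ≠ 0`, so the right factor is polynomial in `z⁻¹`.
  obtain ⟨k, hk, hmin⟩ := Finset.exists_min_image _ κ hne
  have hk : v k ≠ 0 := by simpa using hk
  wlog h1 : v k = 1 generalizing v
  · refine this ((v k)⁻¹ • v) (by simp [hk, hv]) (by rw [Matrix.mulVec_smul, hPv, smul_zero]) ?_
      (by simp [hk]) (by simpa [hk] using hmin) (by simp [hk]) (by simp [hk])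
    exact ⟨k, by simp [hk]⟩
  have hdvd : ∀ i, (X - C z₀) ∣ (P.mulVec fun j => C (v j)) i := by
    intro i
    rw [dvd_iff_isRoot]
    have := congrFun hPv i
    simpa [Matrix.mulVec, dotProduct, polyEval, IsRoot, eval_finsetSum] using this
  choose c hc using hdvd
  -- Column `k` of `P` equals `P v` minus the other columns weighted by `v`, and `P v = (X - C z₀)
  -- c`. So `P` is recovered from `P.updateCol k c` by a matrix with column `m`. Moving that matrix
  -- past the diagonal factor turns `m` into `q` evaluated at `z⁻¹`, and `z - z₀ = z (1 - z₀ z⁻¹)`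
  -- raises `κ k` by one.
  set m : n → ℂ[X] := fun i => if i = k then X - C z₀ else - C (v i) with hm
  set q : n → ℂ[X] := fun i => if i = k then 1 - C z₀ * X else - C (v i) * X ^ (κ i - κ k).toNat
    with hq
  have hPM : P = P.updateCol k c * (1 : Matrix n n ℂ[X]).updateCol k m := by
    have hcol : (P.updateCol k c).mulVec m = fun i => P i k := by
      funext i
      have h2 : ∑ j, P i j * C (v j) = (X - C z₀) * c i := hc i
      rw [← Finset.add_sum_erase _ _ (Finset.mem_univ k), h1, C_1, mul_one] at h2
      rw [Matrix.mulVec, dotProduct, ← Finset.add_sum_erase _ _ (Finset.mem_univ k),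
        Finset.sum_congr rfl (g := fun j => - (P i j * C (v j))) fun j hj => ?_]
      · rw [Finset.sum_neg_distrib, ← sub_eq_add_neg, sub_eq_iff_eq_add, h2]
        simp [hm, mul_comm]
      · have hjk := Finset.ne_of_mem_erase hj
        simp [hm, hjk]
    have hcol' : ∀ i, ∑ l, P.updateCol k c i l * m l = P i k := fun i => congrFun hcol i
    ext1 i j
    rw [Matrix.mul_apply]
    by_cases hj : j = k
    · subst hj
      simp [hcol']
    · simp [Matrix.updateCol_ne hj, Matrix.one_apply]
  refine ⟨P.updateCol k c, fun j => if j = k then κ j + 1 else κ j,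
    (1 : Matrix n n ℂ[X]).updateCol k q, ?_, ?_, ?_⟩
  · conv_lhs => rw [hPM]
    rw [Matrix.det_mul, det_updateCol_one]
    simp [hm]
  · rw [det_updateCol_one]
    simp [hq]
  · intro z hz
    conv_lhs => rw [hPM]
    rw [map_mul, Matrix.mul_assoc, Matrix.mul_assoc]
    congr 1
    ext i j
    rw [Matrix.mul_diagonal, Matrix.diagonal_mul]
    by_cases hj : j = k
    · subst hj
      by_cases hi : i = j
      · subst hi
        simp [polyEval, hm, hq, zpow_add₀ hz]
        field_simp
      · by_cases hvi : v i = 0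
        · simp [polyEval, hm, hq, hi, hvi]
        · have h3 : κ j ≤ κ i := hmin i (by simpa using hvi)
          have h4 : z ^ κ i = z ^ κ j * z ^ (κ i - κ j).toNat := by
            rw [← zpow_natCast, Int.toNat_of_nonneg (by omega), ← zpow_add₀ hz]
            congr 1
            omega
          simp [polyEval, hm, hq, hi, h4]
          field_simp
    · by_cases hi : i = j
      · subst hi
        simp [polyEval, hj]
      · simp [polyEval, Matrix.updateCol_ne hj, hi]

/-- Induction on the degree of the determinant: each root in the disc is removed from `P` at the
cost of a right factor with determinant `1 - z₀ X`. That determinant has no zero in the closed disc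
because `‖z₀‖ < 1`, there being no roots on the circle. -/
theorem exists_polynomial_factorization {n : Type*} [Fintype n] [DecidableEq n] (N : ℕ) :
    ∀ (P : Matrix n n ℂ[X]) (κ : n → ℤ), P.det.natDegree = N →
      (∀ z : ℂ, ‖z‖ = 1 → P.det.eval z ≠ 0) →
    ∃ (P' : Matrix n n ℂ[X]) (κ' : n → ℤ) (Q : Matrix n n ℂ[X]),
      (∀ z : ℂ, ‖z‖ ≤ 1 → P'.det.eval z ≠ 0) ∧ (∀ z : ℂ, ‖z‖ ≤ 1 → Q.det.eval z ≠ 0) ∧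
      ∀ z : ℂ, z ≠ 0 → polyEval z P * Matrix.diagonal (fun j => z ^ κ j) =
        polyEval z P' * Matrix.diagonal (fun j => z ^ κ' j) * polyEval z⁻¹ Q := by
  induction N with
  | zero =>
    intro P κ hN hP
    refine ⟨P, κ, 1, fun z _ => ?_, by simp, by simp⟩
    -- A constant determinant that is non-zero at one point of the circle is non-zero everywhere.
    have h1 := hP 1 (by simp)
    rw [eq_C_of_natDegree_eq_zero hN] at h1 ⊢
    simpa using h1
  | succ N ih =>
    intro P κ hN hP
    by_cases hroot : ∀ z : ℂ, ‖z‖ ≤ 1 → P.det.eval z ≠ 0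
    · exact ⟨P, κ, 1, hroot, by simp, by simp⟩
    push Not at hroot
    obtain ⟨z₀, hz₀, h0⟩ := hroot
    have hlt : ‖z₀‖ < 1 := lt_of_le_of_ne hz₀ fun h => hP z₀ h h0
    obtain ⟨P₁, κ₁, Q₁, hd, hQ₁, hfac⟩ := exists_polyEval_mul_diagonal_of_isRoot P κ h0
    have hne : P₁.det ≠ 0 := by
      rintro h
      rw [h, zero_mul] at hd
      simp [hd] at hN
    obtain ⟨P', κ', Q, hP', hQ, hfac'⟩ := ih P₁ κ₁ (by
      rw [hd, natDegree_mul hne (X_sub_C_ne_zero z₀), natDegree_X_sub_C] at hN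
      omega) (fun z hz h => hP z hz (by rw [hd, eval_mul, h, zero_mul]))
    refine ⟨P', κ', Q * Q₁, hP', fun z hz => ?_, fun z hz => ?_⟩
    · rw [Matrix.det_mul, eval_mul, hQ₁]
      refine mul_ne_zero (hQ z hz) fun h => ?_
      have h2 : z₀ * z = 1 := by
        simp only [eval_sub, eval_one, eval_mul, eval_C, eval_X] at h
        exact (sub_eq_zero.1 h).symm
      have h3 : ‖z₀‖ * ‖z‖ = 1 := by rw [← norm_mul, h2, norm_one]
      nlinarith [norm_nonneg z₀, norm_nonneg z]
    · rw [hfac z hz, hfac' z hz, map_mul, Matrix.mul_assoc, Matrix.mul_assoc]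

theorem hasSum_polyEval {n : Type*} [Fintype n] [DecidableEq n] (P : Matrix n n ℂ[X]) (z : ℂ) :
    HasSum (fun k => z ^ k • P.map fun p => p.coeff k) (polyEval z P) := by
  refine Pi.hasSum.2 fun i => Pi.hasSum.2 fun j => ?_
  have h : polyEval z P i j = ∑ k ∈ (P i j).support, z ^ k * (P i j).coeff k := by
    simp [polyEval, eval_eq_sum, Polynomial.sum, mul_comm]
  rw [h]
  exact hasSum_sum_of_ne_finset_zero fun k hk => by simp [notMem_support_iff.1 hk]

theorem summable_norm_coeff (p : ℂ[X]) : Summable fun k => ‖p.coeff k‖ :=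
  summable_of_ne_finset_zero (s := p.support) fun k hk => by simp [notMem_support_iff.1 hk]

theorem isPlusFactor_polyEval {m : ℕ} {P : Matrix (Fin m) (Fin m) ℂ[X]}
    (hP : ∀ z : ℂ, ‖z‖ ≤ 1 → P.det.eval z ≠ 0) : IsPlusFactor fun z => polyEval z P :=
  ⟨fun k => P.map fun p => p.coeff k, fun i j => summable_norm_coeff (P i j),
    fun z _ => hasSum_polyEval P z, fun z hz => isUnit_polyEval.2 (hP z hz)⟩

theorem isMinusFactor_polyEval {m : ℕ} {P : Matrix (Fin m) (Fin m) ℂ[X]}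
    (hP : ∀ z : ℂ, ‖z‖ ≤ 1 → P.det.eval z ≠ 0) : IsMinusFactor fun z => polyEval z⁻¹ P := by
  refine ⟨fun k => P.map fun p => p.coeff k, fun i j => summable_norm_coeff (P i j),
    fun z _ => hasSum_polyEval P z⁻¹, fun z hz => isUnit_polyEval.2 (hP _ ?_), ?_⟩
  · rw [norm_inv]
    exact inv_le_one_of_one_le₀ hz
  · have h : (P.map fun p => p.coeff 0) = polyEval 0 P := by
      ext i j
      simp [polyEval, coeff_zero_eq_eval_zero]
    change IsUnit (P.map fun p => p.coeff 0)
    rw [h]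
    exact isUnit_polyEval.2 (hP 0 (by simp))

theorem exists_polyEval_eq_blockSymbol {m : ℕ} (x : ℤ →₀ Matrix (Fin m) (Fin m) ℂ) :
    ∃ (P : Matrix (Fin m) (Fin m) ℂ[X]) (N : ℕ), ∀ z : ℂ, z ≠ 0 →
      blockSymbol x z = polyEval z P * Matrix.diagonal fun _ => z ^ (-(N : ℤ)) := by
  -- Multiplication by `z ^ N` clears every negative power.
  set N : ℕ := x.support.sup Int.natAbs with hN
  refine ⟨fun i j => ∑ r ∈ x.support, C (x r i j) * X ^ (r + N).toNat, N, fun z hz => ?_⟩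
  ext i j
  rw [Matrix.mul_diagonal, blockSymbol, Finsupp.sum, Matrix.sum_apply]
  have h : polyEval z (fun i j => ∑ r ∈ x.support, C (x r i j) * X ^ (r + N).toNat) i j =
      ∑ r ∈ x.support, x r i j * z ^ (r + N).toNat := by
    change eval z (∑ r ∈ x.support, C (x r i j) * X ^ (r + N).toNat) = _
    simp [eval_finsetSum]
  rw [h, Finset.sum_mul]
  refine Finset.sum_congr rfl fun r hr => ?_
  have h1 : r.natAbs ≤ N := Finset.le_sup (f := Int.natAbs) hr
  rw [← zpow_natCast z, Int.toNat_of_nonneg (by omega), mul_assoc, ← zpow_add₀ hz,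
    Matrix.smul_apply, smul_eq_mul, mul_comm]
  congr 2
  ring

/-- A matrix Laurent polynomial that is invertible on the unit circle has a left Wiener-Hopf
factorization. -/
theorem exists_hasLeftPartialIndices {m : ℕ} (x : ℤ →₀ Matrix (Fin m) (Fin m) ℂ)
    (hx : ∀ z : ℂ, ‖z‖ = 1 → IsUnit (blockSymbol x z)) :
    ∃ κ, HasLeftPartialIndices (blockSymbol x) κ := by
  obtain ⟨P, N, hP⟩ := exists_polyEval_eq_blockSymbol x
  have hne : ∀ z : ℂ, ‖z‖ = 1 → z ≠ 0 := by
    rintro z hz rfl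
    simp at hz
  obtain ⟨P', κ, Q, hP', hQ, h⟩ := exists_polynomial_factorization _ P (fun _ => -(N : ℤ)) rfl
    fun z hz => by
      have h1 := hx z hz
      rw [hP z (hne z hz), Matrix.isUnit_iff_isUnit_det, Matrix.det_mul] at h1
      exact isUnit_polyEval.1 ((Matrix.isUnit_iff_isUnit_det _).2 (isUnit_of_mul_isUnit_left h1))
  exact ⟨κ, _, _, isPlusFactor_polyEval hP', isMinusFactor_polyEval hQ, fun z hz => by
    rw [hP z (hne z hz), h z (hne z hz)]⟩

end PolynomialMatrix

/-! ### From factorizations of the symbol to factorizations of the operator -/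

/-- The map `toEuclideanCLM` preserves sums of series. -/
theorem HasSum.toEuclideanCLM {m : ℕ} {ι : Type*} {f : ι → Matrix (Fin m) (Fin m) ℂ}
    {A : Matrix (Fin m) (Fin m) ℂ} (h : HasSum f A) :
    HasSum (fun p => Matrix.toEuclideanCLM (𝕜 := ℂ) (f p)) (Matrix.toEuclideanCLM (𝕜 := ℂ) A) :=
  h.map (Matrix.toEuclideanCLM (𝕜 := ℂ) (n := Fin m))
    (LinearMap.continuous_of_finiteDimensional
      (Matrix.toEuclideanCLM (𝕜 := ℂ) (n := Fin m)).toAlgEquiv.toLinearMap)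

theorem exists_isToeplitzSum_of_isPlusFactor {m : ℕ} {A : ℂ → Matrix (Fin m) (Fin m) ℂ}
    (h : IsPlusFactor A) (r : ℤ) : ∃ (a : ℕ → Matrix (Fin m) (Fin m) ℂ)
      (Y : HalfLineSpace m →L[ℂ] HalfLineSpace m),
      IsToeplitzSum (fun k : ℕ => (k : ℤ) * r) a Y (fun z => A (z ^ r)) ∧ IsUnit Y := by
  obtain ⟨a, ha, hA, hu⟩ := h
  have hs := summable_norm_toEuclideanCLM ha
  have hY := (summable_norm_shiftTensor (fun k : ℕ => (k : ℤ) * r) hs).of_norm.hasSum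
  refine ⟨a, _, ⟨hs, hY, fun z hz => ?_⟩, isUnit_of_hasSum_shiftTensor r ha hA hu hY⟩
  refine (hA (z ^ r) (by simp [hz])).toEuclideanCLM.congr_fun fun k => ?_
  rw [map_smul, mul_comm, zpow_mul, zpow_natCast]

/-- The value of `B` at `0` must be `a 0`, the value of `A` at infinity. The expression `A 0⁻¹`
means `A 0` by convention and carries no information, hence the case split in the witness. -/
theorem exists_isPlusFactor_of_isMinusFactor {m : ℕ} {A : ℂ → Matrix (Fin m) (Fin m) ℂ}
    (h : IsMinusFactor A) : ∃ B, IsPlusFactor B ∧ ∀ z : ℂ, z ≠ 0 → B z = A z⁻¹ := by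
  obtain ⟨a, ha, hA, hu, h0⟩ := h
  have hinv : ∀ w : ℂ, w ≠ 0 → ‖w‖ ≤ 1 → 1 ≤ ‖w⁻¹‖ := by
    intro w h hw
    rw [norm_inv]
    exact (one_le_inv₀ (norm_pos_iff.2 h)).2 hw
  refine ⟨fun w => if w = 0 then a 0 else A w⁻¹, ⟨a, ha, fun w hw => ?_, fun w hw => ?_⟩,
    fun z hz => if_neg hz⟩
  · dsimp only
    split_ifs with h
    · subst h
      convert hasSum_single (f := fun k => (0 : ℂ) ^ k • a k) 0 (fun k hk => by simp [hk]) using 1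
      simp
    · simpa using hA w⁻¹ (hinv w h hw)
  · dsimp only
    split_ifs with h
    · exact h0
    · exact hu w⁻¹ (hinv w h hw)

theorem isMinusFactor_of_isPlusFactor {m : ℕ} {A : ℂ → Matrix (Fin m) (Fin m) ℂ}
    (h : IsPlusFactor A) : IsMinusFactor fun z => A z⁻¹ := by
  obtain ⟨a, ha, hA, hu⟩ := h
  have hinv : ∀ z : ℂ, 1 ≤ ‖z‖ → ‖z⁻¹‖ ≤ 1 := by
    intro z hz
    rw [norm_inv]
    exact inv_le_one_of_one_le₀ hz
  refine ⟨a, ha, fun z hz => hA _ (hinv z hz), fun z hz => hu _ (hinv z hz), ?_⟩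
  have h1 := hasSum_single (f := fun k => (0 : ℂ) ^ k • a k) 0 (fun k hk => by simp [hk])
  rw [pow_zero, one_smul] at h1
  rw [h1.unique (hA 0 (by simp))]
  exact hu 0 (by simp)

theorem diagonal_eq_sum_single {m : ℕ} (d : Fin m → ℂ) :
    Matrix.diagonal d = ∑ j, d j • Matrix.single j j (1 : ℂ) := by
  ext i k
  simp only [Matrix.sum_apply, Matrix.smul_apply, Matrix.single_apply, Matrix.diagonal_apply]
  by_cases h : i = k
  · subst h
    simp
  · simp only [h, if_false]
    refine (Finset.sum_eq_zero fun j _ => ?_).symm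
    rw [if_neg (fun hj => h (hj.1.symm.trans hj.2)), smul_zero]

theorem isToeplitzSum_diagonal {m : ℕ} (κ : Fin m → ℤ) :
    IsToeplitzSum κ (fun j => Matrix.single j j (1 : ℂ))
      (∑ j, shiftTensor (κ j) (Matrix.single j j (1 : ℂ)))
      fun z => Matrix.diagonal fun j => z ^ κ j := by
  refine ⟨Summable.of_finite, hasSum_fintype _, fun z _ => ?_⟩
  rw [diagonal_eq_sum_single, map_sum]
  simp only [map_smul]
  exact hasSum_fintype _

theorem isToeplitzSum_blockToeplitz {m : ℕ} (x : ℤ →₀ Matrix (Fin m) (Fin m) ℂ) :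
    IsToeplitzSum (fun r : x.support => (r : ℤ)) (fun r => x r) (blockToeplitz x)
      (blockSymbol x) := by
  refine ⟨Summable.of_finite, ?_, fun z _ => ?_⟩
  · exact x.support.hasSum fun r => shiftTensor r (x r)
  · rw [blockSymbol, Finsupp.sum, map_sum]
    simp only [map_smul]
    exact x.support.hasSum fun r => z ^ r • Matrix.toEuclideanCLM (𝕜 := ℂ) (x r)

/-- The operator `⊕_j T ^ κ_j` is invertible only if all exponents vanish. -/
theorem isUnit_diagonal_shift_iff {m : ℕ} (κ : Fin m → ℤ) :
    IsUnit (∑ j, shiftTensor (κ j) (Matrix.single j j (1 : ℂ)) :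
      HalfLineSpace m →L[ℂ] HalfLineSpace m) ↔ ∀ j, κ j = 0 := by
  set D : HalfLineSpace m →L[ℂ] HalfLineSpace m :=
    ∑ j, shiftTensor (κ j) (Matrix.single j j (1 : ℂ)) with hD
  have hcoord : ∀ (u : HalfLineSpace m) (i : ℕ) (j : Fin m),
      D u i j = if 0 ≤ (i : ℤ) + κ j then u ((i : ℤ) + κ j).toNat j else 0 := by
    intro u i j
    have h1 : D u i = ∑ k, shiftTensor (κ k) (Matrix.single k k (1 : ℂ)) u i := by
      rw [hD, _root_.sum_apply, lp.coeFn_sum, Finset.sum_apply]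
    have h2 : D u i j = ∑ k, shiftTensor (κ k) (Matrix.single k k (1 : ℂ)) u i j := by
      rw [h1, WithLp.ofLp_sum, Finset.sum_apply]
    rw [h2, Finset.sum_eq_single j]
    · rw [shiftTensor_apply]
      split_ifs
      · simp [Matrix.single_mulVec]
      · rfl
    · intro k _ hk
      rw [shiftTensor_apply]
      split_ifs
      · simp [Matrix.single_mulVec, hk.symm]
      · rfl
    · simp
  constructor
  · intro h j
    obtain ⟨E, hE⟩ := h
    have hE1 : ∀ u, D ((E⁻¹ : (HalfLineSpace m →L[ℂ] HalfLineSpace m)ˣ).1 u) = u := fun u => by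
      rw [← hE, ← mul_apply_eq_comp, Units.mul_inv, one_apply_eq_self]
    have hE2 : ∀ u, (E⁻¹ : (HalfLineSpace m →L[ℂ] HalfLineSpace m)ˣ).1 (D u) = u := fun u => by
      rw [← hE, ← mul_apply_eq_comp, Units.inv_mul, one_apply_eq_self]
    set e : HalfLineSpace m := lp.single (E := fun _ : ℕ => EuclideanSpace ℂ (Fin m)) 2 0
      (EuclideanSpace.single j 1) with he
    have he0 : e 0 j = 1 := by
      rw [he, lp.single_apply_self]
      simp
    have hei : ∀ i k, (i ≠ 0 ∨ k ≠ j) → e i k = 0 := by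
      intro i k h
      by_cases hi : i = 0
      · subst hi
        rw [he, lp.single_apply_self]
        simp [h.resolve_left (by simp)]
      · rw [he, lp.single_apply_ne _ _ _ hi]
        rfl
    -- If `κ j < 0`, coordinate `j` at the first site vanishes on the range of `D`, which therefore
    -- misses `e`. If `κ j > 0`, the vector `e` is in the kernel.
    rcases lt_trichotomy (κ j) 0 with h | h | h
    · have h1 := hcoord ((E⁻¹ : (HalfLineSpace m →L[ℂ] HalfLineSpace m)ˣ).1 e) 0 j
      rw [hE1, he0, if_neg (by simpa using h)] at h1
      exact absurd h1 one_ne_zero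
    · exact h
    · have h1 : D e = 0 := by
        ext i k
        rw [hcoord]
        split_ifs
        · refine hei _ _ ?_
          by_cases hk : k = j
          · subst hk
            exact Or.inl (by omega)
          · exact Or.inr hk
        · rfl
      have h2 := hE2 e
      rw [h1, map_zero] at h2
      rw [← h2] at he0
      exact absurd he0 (by simp)
  · intro h
    have : D = 1 := by
      ext u i j
      rw [hcoord, h j]
      simp
    rw [this]
    exact isUnit_one

theorem HasLeftPartialIndices.isUnit_blockToeplitz_iff {m : ℕ}
    {x : ℤ →₀ Matrix (Fin m) (Fin m) ℂ} {κ : Fin m → ℤ}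
    (h : HasLeftPartialIndices (blockSymbol x) κ) : IsUnit (blockToeplitz x) ↔ ∀ j, κ j = 0 := by
  obtain ⟨Ap, Am, hp, hm, hfac⟩ := h
  obtain ⟨a, Y, hY, hYu⟩ := exists_isToeplitzSum_of_isPlusFactor hp 1
  obtain ⟨B, hB, hBm⟩ := exists_isPlusFactor_of_isMinusFactor hm
  obtain ⟨b, Z, hZ, hZu⟩ := exists_isToeplitzSum_of_isPlusFactor hB (-1)
  -- The left factor has exponents `k ≥ 0` and the right one exponents `-k ≤ 0`, so both products
  -- are admissible whatever the signs of `κ`.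
  have h1 := (hY.mul (isToeplitzSum_diagonal κ) (Or.inl fun k => by simp)).mul hZ
    (Or.inr fun k => by simp)
  have h2 : blockToeplitz x = _ := (isToeplitzSum_blockToeplitz x).eq_of_symbol_eq h1 fun z hz => by
    have hz0 : z ≠ 0 := by
      rintro rfl
      simp at hz
    rw [hfac z hz, zpow_one, zpow_neg_one, hBm _ (inv_ne_zero hz0), inv_inv]
  obtain ⟨Y, rfl⟩ := hYu
  obtain ⟨Z, rfl⟩ := hZu
  rw [h2, Units.isUnit_mul_units, Units.isUnit_units_mul, isUnit_diagonal_shift_iff]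

/-! ### Singular symbols and truncated plane waves -/

/-- The triangle inequality over single sites. This crude bound suffices, since only independence of
the truncation length matters later. -/
theorem lp_norm_le_card_mul {E : Type*} [NormedAddCommGroup E] (w : lp (fun _ : ℕ => E) 2)
    (s : Finset ℕ) {c : ℝ} (hs : ∀ i ∉ s, w i = 0) (hc : ∀ i, ‖w i‖ ≤ c) :
    ‖w‖ ≤ s.card * c := by
  have h : w = ∑ i ∈ s, lp.single (E := fun _ : ℕ => E) 2 i (w i) := by
    refine (lp.hasSum_single (E := fun _ : ℕ => E) (p := 2) (by norm_num) w).unique ?_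
    refine hasSum_sum_of_ne_finset_zero fun i hi => ?_
    rw [hs i hi]
    exact map_zero (lp.singleAddMonoidHom (E := fun _ : ℕ => E) 2 i)
  rw [h, ← nsmul_eq_mul]
  refine (norm_sum_le _ _).trans (Finset.sum_le_card_nsmul _ _ _ fun i _ => ?_)
  rw [lp.norm_single (by norm_num)]
  exact hc i

theorem exists_lp_of_bounded {E : Type*} [NormedAddCommGroup E] (N : ℕ) (f : ℕ → E) (c : ℝ)
    (hf : ∀ i < N, ‖f i‖ = c) :
    ∃ u : lp (fun _ : ℕ => E) 2, (∀ i, u i = if i < N then f i else 0) ∧ ‖u‖ ^ 2 = N * c ^ 2 := by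
  have hmem : Memℓp (fun i => if i < N then f i else 0) 2 :=
    memℓp_gen (summable_of_ne_finset_zero (s := Finset.range N) fun i hi => by
      simp only [Finset.mem_range] at hi
      simp [hi])
  refine ⟨⟨_, hmem⟩, fun i => rfl, ?_⟩
  have h1 := lp.norm_rpow_eq_tsum (p := 2) (by norm_num) (⟨_, hmem⟩ : lp (fun _ : ℕ => E) 2)
  simp only [ENNReal.toReal_ofNat, Real.rpow_ofNat] at h1
  rw [h1, tsum_eq_sum (s := Finset.range N)]
  · rw [Finset.sum_congr rfl (g := fun _ => c ^ 2)]
    · simp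
    · intro i hi
      have := Finset.mem_range.1 hi
      simp [this, hf i this]
  · intro i hi
    simp only [Finset.mem_range] at hi
    simp [hi]

/-- A block-Toeplitz operator is not invertible if its symbol is singular at a point of the unit
circle. -/
theorem isUnit_blockSymbol_of_isUnit_blockToeplitz {m : ℕ} (x : ℤ →₀ Matrix (Fin m) (Fin m) ℂ)
    (hx : IsUnit (blockToeplitz x)) {z : ℂ} (hz : ‖z‖ = 1) : IsUnit (blockSymbol x z) := by
  by_contra hsing
  have hdet : (blockSymbol x z).det = 0 := by
    simpa [Matrix.isUnit_iff_isUnit_det] using hsing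
  have hz0 : z ≠ 0 := by
    rintro rfl
    simp at hz
  obtain ⟨v', hv', hxv'⟩ := Matrix.exists_mulVec_eq_zero_iff.2 hdet
  obtain ⟨v, rfl⟩ := (WithLp.linearEquiv 2 ℂ (Fin m → ℂ)).surjective v'
  have hv : v ≠ 0 := by
    rintro rfl
    exact hv' (map_zero _)
  have hxv : Matrix.toEuclideanCLM (𝕜 := ℂ) (blockSymbol x z) v = 0 :=
    (WithLp.linearEquiv 2 ℂ (Fin m → ℂ)).injective (hxv'.trans (map_zero _).symm)
  set L := Matrix.toEuclideanCLM (𝕜 := ℂ) (n := Fin m) with hL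
  have hsum : ∑ r ∈ x.support, z ^ r • L (x r) v = 0 := by
    rw [← hxv, blockSymbol, Finsupp.sum, map_sum, _root_.sum_apply]
    exact Finset.sum_congr rfl fun r _ => by rw [map_smul]; rfl
  set K : ℕ := x.support.sup Int.natAbs with hK
  have hKr : ∀ r ∈ x.support, r.natAbs ≤ K := fun r hr => Finset.le_sup (f := Int.natAbs) hr
  set c : ℝ := ∑ r ∈ x.support, ‖L (x r)‖ * ‖v‖ with hc
  have hc0 : 0 ≤ c := Finset.sum_nonneg fun r _ => by positivity
  obtain ⟨E, hE⟩ := hx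
  set G : HalfLineSpace m →L[ℂ] HalfLineSpace m :=
    (E⁻¹ : (HalfLineSpace m →L[ℂ] HalfLineSpace m)ˣ).1 with hG
  have hGX : ∀ u, G (blockToeplitz x u) = u := fun u => by
    rw [← hE, ← mul_apply_eq_comp, Units.inv_mul, one_apply_eq_self]
  -- The wave `z ^ i • v`, cut off at `i < N`, has squared norm `N * ‖v‖ ^ 2`, while its image is
  -- bounded independently of `N`. A bounded left inverse `G` then bounds `N`, a contradiction.
  have key : ∀ N : ℕ, N * ‖v‖ ^ 2 ≤ (‖G‖ * (3 * K * c)) ^ 2 := by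
    intro N
    obtain ⟨u, hu, hnorm⟩ := exists_lp_of_bounded N (fun i => z ^ i • v) ‖v‖
      fun i _ => by simp [norm_smul, hz]
    rw [← hnorm]
    have hterm : ∀ i r, shiftSeq r (x r) (fun n => u n) i =
        if 0 ≤ (i : ℤ) + r ∧ (i : ℤ) + r < N then z ^ i • z ^ r • L (x r) v else 0 := by
      intro i r
      unfold shiftSeq
      beta_reduce
      by_cases h1 : 0 ≤ (i : ℤ) + r
      · rw [if_pos h1, hu]
        by_cases h2 : (i : ℤ) + r < N
        · rw [if_pos (by omega), if_pos ⟨h1, h2⟩, map_smul, smul_smul, ← zpow_natCast z,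
            Int.toNat_of_nonneg h1, zpow_add₀ hz0, zpow_natCast]
        · rw [if_neg (by omega), if_neg (fun h => h2 h.2), map_zero]
      · rw [if_neg h1, if_neg (fun h => h1 h.1)]
    have hbound : ‖blockToeplitz x u‖ ≤ 3 * K * c := by
      -- The bandwidth is `K`: away from the two cut-offs, row `i` sees the full wave and gives `z ^
      -- i • x(z) v = 0`, and from `N + K` on it sees nothing. At most `3 * K` rows remain, also
      -- when `N - K` is truncated to zero.
      refine (lp_norm_le_card_mul _ (Finset.range K ∪ Finset.Ico (N - K) (N + K)) (c := c)
        (fun i hi => ?_) fun i => ?_).trans ?_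
      · rw [blockToeplitz_apply]
        simp only [Finset.mem_union, Finset.mem_range, Finset.mem_Ico, not_or, not_and,
          not_lt] at hi
        by_cases h : i < N
        · rw [← smul_zero (z ^ i), ← hsum, Finset.smul_sum]
          refine Finset.sum_congr rfl fun r hr => ?_
          have := hKr r hr
          rw [hterm, if_pos (by omega)]
        · refine Finset.sum_eq_zero fun r hr => ?_
          have := hKr r hr
          rw [hterm, if_neg (by omega)]
      · rw [blockToeplitz_apply]
        refine (norm_sum_le _ _).trans (Finset.sum_le_sum fun r _ => ?_)
        rw [hterm]
        split_ifs
        · simpa [norm_smul, hz] using (L (x r)).le_opNorm v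
        · rw [norm_zero]
          positivity
      · refine mul_le_mul_of_nonneg_right ?_ hc0
        have h1 := Finset.card_union_le (Finset.range K) (Finset.Ico (N - K) (N + K))
        rw [Finset.card_range, Nat.card_Ico] at h1
        have h2 : (Finset.range K ∪ Finset.Ico (N - K) (N + K)).card ≤ 3 * K := by omega
        exact_mod_cast h2
    have h3 : ‖u‖ ≤ ‖G‖ * (3 * K * c) := by
      conv_lhs => rw [← hGX u]
      exact (G.le_opNorm _).trans (mul_le_mul_of_nonneg_left hbound (norm_nonneg _))
    exact pow_le_pow_left₀ (norm_nonneg _) h3 2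
  have hvpos : 0 < ‖v‖ ^ 2 := by positivity
  obtain ⟨N, hN⟩ := exists_nat_gt ((‖G‖ * (3 * K * c)) ^ 2 / ‖v‖ ^ 2)
  rw [div_lt_iff₀ hvpos] at hN
  exact absurd (key N) (not_le.2 hN)

/-! ### The invertibility criterion and the two spectra -/

theorem isUnit_blockToeplitz_iff {m : ℕ} (x : ℤ →₀ Matrix (Fin m) (Fin m) ℂ) :
    IsUnit (blockToeplitz x) ↔ (∀ z : ℂ, ‖z‖ = 1 → IsUnit (blockSymbol x z)) ∧
      ∀ κ, HasLeftPartialIndices (blockSymbol x) κ → ∀ j, κ j = 0 := by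
  refine ⟨fun h => ⟨fun z hz => isUnit_blockSymbol_of_isUnit_blockToeplitz x h hz,
    fun κ hκ => hκ.isUnit_blockToeplitz_iff.1 h⟩, fun ⟨h1, h2⟩ => ?_⟩
  obtain ⟨κ, hκ⟩ := exists_hasLeftPartialIndices x h1
  exact hκ.isUnit_blockToeplitz_iff.2 (h2 κ hκ)

theorem forall_norm_eq_one_iff {p : ℂ → Prop} :
    (∀ z : ℂ, ‖z‖ = 1 → p z) ↔ ∀ k : ℝ, p (Complex.exp (Complex.I * k)) := by
  refine ⟨fun h k => h _ (norm_exp_I_mul k), fun h z hz => ?_⟩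
  obtain ⟨k, rfl⟩ := (Complex.norm_eq_one_iff z).1 hz
  rw [mul_comm]
  exact h k

theorem blockToeplitz_sub_single {m : ℕ} (x : ℤ →₀ Matrix (Fin m) (Fin m) ℂ) (lam : ℂ) :
    blockToeplitz (x - Finsupp.single 0 (lam • 1)) =
      blockToeplitz x - algebraMap ℂ (HalfLineSpace m →L[ℂ] HalfLineSpace m) lam := by
  have h := Finsupp.sum_sub_index (f := x)
    (g := Finsupp.single 0 (lam • (1 : Matrix (Fin m) (Fin m) ℂ))) (h := fun r A => shiftTensor r A)
    fun r A B => map_sub (AddMonoidHom.mk' (shiftTensor (m := m) r) (shiftTensor_add r)) A B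
  have h0 : (Finsupp.single (0 : ℤ) (lam • (1 : Matrix (Fin m) (Fin m) ℂ))).sum
      (fun r A => shiftTensor r A) = shiftTensor 0 (lam • 1) :=
    Finsupp.sum_single_index
      (map_zero (AddMonoidHom.mk' (shiftTensor (m := m) 0) (shiftTensor_add 0)))
  rw [h0, shiftTensor_smul, shiftTensor_zero_one] at h
  rw [Algebra.algebraMap_eq_smul_one]
  exact h

theorem blockSymbol_sub_single {m : ℕ} (x : ℤ →₀ Matrix (Fin m) (Fin m) ℂ) (lam z : ℂ) :
    blockSymbol (x - Finsupp.single 0 (lam • 1)) z = blockSymbol x z - lam • 1 := by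
  have h := Finsupp.sum_sub_index (f := x)
    (g := Finsupp.single 0 (lam • (1 : Matrix (Fin m) (Fin m) ℂ))) (h := fun r A => z ^ r • A)
    fun r A B => smul_sub _ A B
  have h0 : (Finsupp.single (0 : ℤ) (lam • (1 : Matrix (Fin m) (Fin m) ℂ))).sum
      (fun r A => z ^ r • A) = z ^ (0 : ℤ) • lam • 1 :=
    Finsupp.sum_single_index (smul_zero _)
  rw [zpow_zero, one_smul] at h0
  exact h.trans (congrArg (fun B => blockSymbol x z - B) h0)

theorem mem_spectrum_blockToeplitz_iff {m : ℕ} (x : ℤ →₀ Matrix (Fin m) (Fin m) ℂ) (lam : ℂ) :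
    lam ∈ spectrum ℂ (blockToeplitz x) ↔
      (∃ k : ℝ, lam ∈ spectrum ℂ (blockSymbol x (Complex.exp (Complex.I * k)))) ∨
      (∃ κ : Fin m → ℤ,
        HasLeftPartialIndices
          (fun z => blockSymbol x z - lam • (1 : Matrix (Fin m) (Fin m) ℂ)) κ ∧
        ∃ j, κ j ≠ 0) := by
  have h := isUnit_blockToeplitz_iff (x - Finsupp.single 0 (lam • 1))
  rw [blockToeplitz_sub_single, funext (blockSymbol_sub_single x lam), forall_norm_eq_one_iff] at h
  rw [spectrum.mem_iff, IsUnit.sub_iff, h, not_and_or]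
  simp only [spectrum.mem_iff, not_forall, exists_prop, Algebra.algebraMap_eq_smul_one, ne_eq]
  refine or_congr (exists_congr fun k => not_congr IsUnit.sub_iff) Iff.rfl

theorem blockSymbol_reflectCoeff {m : ℕ} (x : ℤ →₀ Matrix (Fin m) (Fin m) ℂ) (z : ℂ) :
    blockSymbol (reflectCoeff x) z = blockSymbol x z⁻¹ := by
  unfold blockSymbol reflectCoeff
  rw [Finsupp.sum_equivMapDomain]
  simp [Finsupp.sum]

/-- Inversion of `z` preserves the circle, exchanges plus and minus factors without changing their
order, and negates the exponents of the diagonal factor. -/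
theorem HasRightPartialIndices.comp_inv {m : ℕ} {y : ℂ → Matrix (Fin m) (Fin m) ℂ}
    {μ : Fin m → ℤ} (h : HasRightPartialIndices y μ) :
    HasLeftPartialIndices (fun z => y z⁻¹) (-μ) := by
  obtain ⟨Bm, Bp, hm, hp, hfac⟩ := h
  obtain ⟨A, hA, hAm⟩ := exists_isPlusFactor_of_isMinusFactor hm
  refine ⟨A, _, hA, isMinusFactor_of_isPlusFactor hp, fun z hz => ?_⟩
  have hz0 : z ≠ 0 := by
    rintro rfl
    simp at hz
  dsimp only
  rw [hfac z⁻¹ (by simp [hz]), hAm z hz0]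
  simp

theorem HasLeftPartialIndices.comp_inv {m : ℕ} {y : ℂ → Matrix (Fin m) (Fin m) ℂ}
    {κ : Fin m → ℤ} (h : HasLeftPartialIndices y κ) :
    HasRightPartialIndices (fun z => y z⁻¹) (-κ) := by
  obtain ⟨Ap, Am, hp, hm, hfac⟩ := h
  obtain ⟨A, hA, hAm⟩ := exists_isPlusFactor_of_isMinusFactor hm
  refine ⟨_, A, isMinusFactor_of_isPlusFactor hp, hA, fun z hz => ?_⟩
  have hz0 : z ≠ 0 := by
    rintro rfl
    simp at hz
  dsimp only
  rw [hfac z⁻¹ (by simp [hz]), hAm z hz0]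
  simp

theorem mainTheorem3 (m : ℕ) (x : ℤ →₀ Matrix (Fin m) (Fin m) ℂ) (lam : ℂ) :
    (lam ∈ spectrum ℂ (blockToeplitz x) ↔
      (∃ k : ℝ, lam ∈ spectrum ℂ (blockSymbol x (Complex.exp (Complex.I * k)))) ∨
      (∃ κ : Fin m → ℤ,
        HasLeftPartialIndices
          (fun z => blockSymbol x z - lam • (1 : Matrix (Fin m) (Fin m) ℂ)) κ ∧
        ∃ j, κ j ≠ 0)) ∧
    (lam ∈ spectrum ℂ (associatedBlockToeplitz x) ↔
      (∃ k : ℝ, lam ∈ spectrum ℂ (blockSymbol x (Complex.exp (Complex.I * k)))) ∨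
      (∃ μ : Fin m → ℤ,
        HasRightPartialIndices
          (fun z => blockSymbol x z - lam • (1 : Matrix (Fin m) (Fin m) ℂ)) μ ∧
        ∃ j, μ j ≠ 0)) := by
  refine ⟨mem_spectrum_blockToeplitz_iff x lam, ?_⟩
  rw [associatedBlockToeplitz, mem_spectrum_blockToeplitz_iff]
  simp only [blockSymbol_reflectCoeff]
  have hexp : ∀ k : ℝ, (Complex.exp (Complex.I * k))⁻¹ = Complex.exp (Complex.I * (-k : ℝ)) := by
    intro k
    rw [← Complex.exp_neg]
    simp
  -- The reflected symbol takes the same values on the circle, with `k` replaced by `-k`. Negating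
  -- the indices does not affect whether one of them is non-zero.
  refine or_congr ⟨fun ⟨k, hk⟩ => ⟨-k, hexp k ▸ hk⟩, fun ⟨k, hk⟩ => ⟨-k, ?_⟩⟩
    ⟨fun ⟨κ, hκ, j, hj⟩ => ⟨-κ, ?_, j, by simpa using hj⟩,
      fun ⟨μ, hμ, j, hj⟩ => ⟨-μ, hμ.comp_inv, j, by simpa using hj⟩⟩
  · rwa [hexp, neg_neg]
  · simpa using hκ.comp_inv
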